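/- Let $n\ge 2$, let $C_n=\langle\omega:\omega^n=1\rangle$, and let $G$ be a finite simple connected graph on which $C_n$ acts faithfully by graph automorphisms, such that every vertex fixed by some $\gamma\in C_n\setminus\{1\}$ is fixed by all of $C_n$, and the vertices fixed by all of $C_n$ form an independent set. (Such a graph is called $C_n$-symmetric.) A *placement* of $G$ is a map $p\colon V(G)\to\mathbb{R}^2$ with $p(u)\ne p(v)$ for every edge $uv$. It is *$C_n$-symmetric* if $p(\omega^k v)=\tau(\omega^k)p(v)$ for all $v\in V(G)$ and all $k$, where $\tau(\omega^k)$ is the rotation about the origin by $2k\pi/n$. A $C_n$-symmetric placement $p$ is *$C_n$-symmetric flexible* if there is a continuous path $t\mapsto p_t$, $t\in[0,1]$, of $C_n$-symmetric placements of $G$ with $p_0=p$ such that $\|p_t(u)-p_t(v)\|=\|p(u)-p(v)\|$ for all edges $uv$ and all $t$, while for some $t$ and some vertices $u,v$ one has $\|p_t(u)-p_t(v)\|\neq\|p(u)-p(v)\|$. A *NAC-colouring* of $G$ is a surjective map $\delta\colon E(G)\to\{\text{red},\text{blue}\}$ such that every cycle of $G$ either is monochromatic or has at least two red and at least two blue edges.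 A red (blue) *component* is a connected component of the graph with vertex set $V(G)$ whose edges are the red (blue) edges of $G$; a component $H$ is *partially invariant* if $\gamma H=H$ for some $\gamma\in C_n\setminus\{1\}$. A NAC-colouring $\delta$ is *$C_n$-symmetric* if $\delta(\gamma e)=\delta(e)$ for all $e\in E(G)$ and $\gamma\in C_n$, and no two distinct partially invariant components of the same colour are joined by an edge of $G$. **Theorem.** $G$ has a $C_n$-symmetric flexible placement in $\mathbb{R}^2$ if and only if $G$ has a $C_n$-symmetric NAC-colouring. -/

import Mathlib

namespace CnFlex

/-! ### Frameworks in the Euclidean plane -/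

/-- The Euclidean plane, with the Euclidean norm. -/
abbrev Plane : Type := EuclideanSpace ℝ (Fin 2)

section Frameworks

variable {V : Type*}

/-- A placement of `G` is a possibly non-injective map that separates adjacent vertices. -/
def IsPlacement (G : SimpleGraph V) (p : V → Plane) : Prop :=
  ∀ u v : V, G.Adj u v → p u ≠ p v

/-- Adjacent vertices have the same distance in `p` and in `q`. -/
def Equivalent (G : SimpleGraph V) (p q : V → Plane) : Prop :=
  ∀ u v : V, G.Adj u v → ‖p u - p v‖ = ‖q u - q v‖

/-- All pairs of vertices have the same distance in `p` and in `q`. -/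
def Congruent (p q : V → Plane) : Prop :=
  ∀ u v : V, ‖p u - p v‖ = ‖q u - q v‖

/-- A flex of `(G, p)`: a continuous path, parametrised by `[0, 1]`, of placements of `G` that are
equivalent to `p`, starting at `p`. -/
structure IsFlex (G : SimpleGraph V) (p : V → Plane) (f : unitInterval → V → Plane) : Prop where
  continuous : Continuous f
  start : f 0 = p
  placement : ∀ t, IsPlacement G (f t)
  equivalent : ∀ t, Equivalent G (f t) p

/-- A flex of `p` is trivial if it stays congruent to `p`. -/
def IsTrivialFlex (p : V → Plane) (f : unitInterval → V → Plane) : Prop :=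
  ∀ t, Congruent (f t) p

end Frameworks

/-! ### Rotational symmetry -/

/-- The cyclic group of order `n`, written multiplicatively. -/
abbrev Cyc (n : ℕ) : Type := Multiplicative (ZMod n)

/-- The generator `ω` of the cyclic group of order `n`. -/
def omega (n : ℕ) : Cyc n := Multiplicative.ofAdd 1

/-- The rotation of the plane by the angle `α` about the origin. -/
noncomputable def rotation (α : ℝ) (x : Plane) : Plane :=
  !₂[Real.cos α * x 0 - Real.sin α * x 1, Real.sin α * x 0 + Real.cos α * x 1]

section Symmetry

variable {V : Type*} {G : SimpleGraph V} {n : ℕ}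

/-- The vertex `v` is fixed by the whole group. -/
def IsInvariantVertex (θ : Cyc n →* (G ≃g G)) (v : V) : Prop :=
  ∀ γ : Cyc n, θ γ v = v

/-- The vertex `v` is fixed by some non-trivial group element. -/
def IsPartiallyInvariantVertex (θ : Cyc n →* (G ≃g G)) (v : V) : Prop :=
  ∃ γ : Cyc n, γ ≠ 1 ∧ θ γ v = v

/-- The action `θ` makes `G` a symmetric graph: it is faithful, every partially invariant vertex is
invariant, and the invariant vertices are independent. -/
structure IsCnSymmetricGraph (θ : Cyc n →* (G ≃g G)) : Prop where
  faithful : Function.Injective θ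
  invariant_of_partially : ∀ v : V, IsPartiallyInvariantVertex θ v → IsInvariantVertex θ v
  independent : G.IsIndepSet {v : V | IsInvariantVertex θ v}

/-- `p (ω ^ k • v)` is the rotation of `p v` by `2kπ/n`. -/
def IsCnSymmetricMap (θ : Cyc n →* (G ≃g G)) (p : V → Plane) : Prop :=
  ∀ (k : ℕ) (v : V), p (θ (omega n ^ k) v) = rotation (2 * (k : ℝ) * Real.pi / (n : ℝ)) (p v)

/-- `p` is a symmetric placement of `G` such that `(G, p)` has a non-trivial flex through symmetric
placements. -/
def IsCnSymmetricFlexiblePlacement (θ : Cyc n →* (G ≃g G)) (p : V → Plane) : Prop :=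
  IsPlacement G p ∧ IsCnSymmetricMap θ p ∧
    ∃ f : unitInterval → V → Plane,
      IsFlex G p f ∧ (∀ t, IsCnSymmetricMap θ (f t)) ∧ ¬ IsTrivialFlex p f

end Symmetry

/-! ### NAC-colourings -/

/-- The two colours. -/
inductive Colour : Type
  | red
  | blue

section Colourings

variable {V : Type*} {G : SimpleGraph V} {n : ℕ}

/-- Both colours occur, and every cycle either is monochromatic or has at least two edges of each
colour. -/
structure IsNAC (δ : G.EdgeLabeling Colour) : Prop where
  surjective : Function.Surjective δ
  cycle : ∀ (v : V) (c : G.Walk v v), c.IsCycle →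
    (∃ k : Colour, ∀ e : G.edgeSet, (e : Sym2 V) ∈ c.edges → δ e = k) ∨
    (∀ k : Colour, ∃ e f : G.edgeSet, e ≠ f ∧
      (e : Sym2 V) ∈ c.edges ∧ (f : Sym2 V) ∈ c.edges ∧ δ e = k ∧ δ f = k)

/-- A connected component of the spanning subgraph of edges of colour `k`, as a subgraph of `G`. -/
def componentSubgraph (δ : G.EdgeLabeling Colour) (k : Colour)
    (H : (δ.labelGraph k).ConnectedComponent) : G.Subgraph where
  verts := H.supp
  Adj u v := (δ.labelGraph k).Adj u v ∧ u ∈ H.supp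
  adj_sub h := SimpleGraph.EdgeLabeling.labelGraph_le δ h.1
  edge_vert h := h.2
  symm := ⟨fun _ _ h => ⟨h.1.symm, H.mem_supp_of_adj_mem_supp h.2 h.1⟩⟩

/-- The image `γ H` of a subgraph `H` of `G` under the action of `γ`. -/
def translate (θ : Cyc n →* (G ≃g G)) (γ : Cyc n) (H : G.Subgraph) : G.Subgraph :=
  H.map (θ γ).toHom

/-- `γ H = H` for some non-trivial `γ`. -/
def IsPartiallyInvariantComponent (θ : Cyc n →* (G ≃g G)) (δ : G.EdgeLabeling Colour) (k : Colour)
    (H : (δ.labelGraph k).ConnectedComponent) : Prop :=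
  ∃ γ : Cyc n, γ ≠ 1 ∧ translate θ γ (componentSubgraph δ k H) = componentSubgraph δ k H

/-- A NAC-colouring that is invariant under the group and in which no edge of `G` joins two distinct
partially invariant components of the same colour. -/
structure IsCnSymmetricNAC (θ : Cyc n →* (G ≃g G)) (δ : G.EdgeLabeling Colour) : Prop where
  nac : IsNAC δ
  invariant : ∀ (γ : Cyc n) (e : G.edgeSet), δ ((θ γ).mapEdgeSet e) = δ e
  not_joined : ∀ (k : Colour) (H₁ H₂ : (δ.labelGraph k).ConnectedComponent), H₁ ≠ H₂ →
    IsPartiallyInvariantComponent θ δ k H₁ → IsPartiallyInvariantComponent θ δ k H₂ →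
    ∀ u ∈ H₁.supp, ∀ v ∈ H₂.supp, ¬ G.Adj u v

end Colourings

end CnFlex

namespace CnFlex

/-! ### The plane as the complex line -/

/-- The isometry of the plane with the complex numbers. -/
noncomputable def toComplex : Plane ≃ₗᵢ[ℝ] ℂ := Complex.orthonormalBasisOneI.repr.symm

theorem toComplex_rotation (α : ℝ) (x : Plane) :
    toComplex (rotation α x) = Complex.exp (α * Complex.I) * toComplex x := by
  simp only [toComplex, Complex.orthonormalBasisOneI_repr_symm_apply, rotation,
    Complex.exp_mul_I]
  apply Complex.ext
  · simp [← Complex.ofReal_cos, ← Complex.ofReal_sin]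
  · simp [← Complex.ofReal_cos, ← Complex.ofReal_sin]
    ring

/-- The character of the cyclic group that gives the action by rotations. -/
noncomputable def rotChar (n : ℕ) [NeZero n] : Cyc n →* ℂ :=
  (ZMod.stdAddChar (N := n)).toMonoidHom

section Char

variable {n : ℕ} [NeZero n]

theorem rotChar_injective : Function.Injective (rotChar n) := fun _ _ h =>
  Multiplicative.toAdd.injective (ZMod.injective_stdAddChar (N := n) h)

theorem norm_rotChar (γ : Cyc n) : ‖rotChar n γ‖ = 1 :=
  Circle.norm_coe (ZMod.toCircle γ.toAdd)

theorem rotChar_ne_one {γ : Cyc n} (h : γ ≠ 1) : rotChar n γ ≠ 1 := fun e =>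
  h (rotChar_injective (e.trans (map_one _).symm))

theorem rotChar_ne_zero (γ : Cyc n) : rotChar n γ ≠ 0 := fun e => by
  simpa [e] using norm_rotChar γ

theorem rotChar_omega_pow (k : ℕ) : rotChar n (omega n ^ k) =
    Complex.exp (((2 * (k : ℝ) * Real.pi / (n : ℝ) : ℝ) : ℂ) * Complex.I) := by
  have h : (omega n ^ k).toAdd = (((k : ℤ)) : ZMod n) := by
    simp [omega]
  rw [rotChar, AddChar.toMonoidHom_apply, h, ZMod.stdAddChar_coe]
  congr 1
  push_cast
  ring

theorem exists_omega_pow (γ : Cyc n) : ∃ k : ℕ, omega n ^ k = γ := by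
  refine ⟨γ.toAdd.val, Multiplicative.toAdd.injective ?_⟩
  simp [omega]

theorem isCnSymmetricMap_iff {V : Type*} {G : SimpleGraph V} {θ : Cyc n →* (G ≃g G)}
    {p : V → Plane} : IsCnSymmetricMap θ p ↔
      ∀ γ v, toComplex (p (θ γ v)) = rotChar n γ * toComplex (p v) := by
  constructor
  · intro h γ v
    obtain ⟨k, rfl⟩ := exists_omega_pow γ
    rw [h, toComplex_rotation, rotChar_omega_pow]
  · intro h k v
    apply toComplex.injective
    rw [h, toComplex_rotation, rotChar_omega_pow]

/-- A finite set with an action of the cyclic group maps equivariantly to the complex line in such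
a way that only elements with non-trivial stabilisers are identified. -/
theorem exists_equivariant (X : Type*) [Finite X] [MulAction (Cyc n) X] :
    ∃ x : X → ℂ, (∀ (γ : Cyc n) (a : X), x (γ • a) = rotChar n γ * x a) ∧
      ∀ a b, x a = x b → a = b ∨
        ((∃ γ : Cyc n, γ ≠ 1 ∧ γ • a = a) ∧ ∃ γ : Cyc n, γ ≠ 1 ∧ γ • b = b) := by
  classical
  obtain ⟨e, he⟩ := exists_injective_nat (MulAction.orbitRel.Quotient (Cyc n) X)
  let cls : X → MulAction.orbitRel.Quotient (Cyc n) X := fun a => Quotient.mk _ a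
  have hcls : ∀ (γ : Cyc n) a, cls (γ • a) = cls a := fun γ a =>
    Quotient.sound ⟨γ, rfl⟩
  have hrep : ∀ a, ∃ γ : Cyc n, γ • (cls a).out = a := fun a =>
    MulAction.orbitRel_apply.1 ((MulAction.orbitRel (Cyc n) X).symm (Quotient.mk_out a))
  choose g hg using hrep
  let P : X → Prop := fun a => ∃ γ : Cyc n, γ ≠ 1 ∧ γ • a = a
  have hP : ∀ (γ : Cyc n) a, P (γ • a) ↔ P a := fun γ a => by
    refine exists_congr fun γ' => and_congr_right fun _ => ?_
    rw [smul_smul, mul_comm, ← smul_smul, smul_left_cancel_iff]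
  let x : X → ℂ := fun a => if P a then 0 else rotChar n (g a) * ((e (cls a) + 1 : ℕ) : ℂ)
  have hx0 : ∀ a, P a → x a = 0 := fun a h => if_pos h
  have hx1 : ∀ a, ¬ P a → x a = rotChar n (g a) * ((e (cls a) + 1 : ℕ) : ℂ) := fun a h => if_neg h
  have hne : ∀ a, ¬ P a → x a ≠ 0 := fun a h => by
    rw [hx1 a h]
    exact mul_ne_zero (rotChar_ne_zero _) (Nat.cast_ne_zero.2 (Nat.succ_ne_zero _))
  refine ⟨x, fun γ a => ?_, fun a b hab => ?_⟩
  · by_cases h : P a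
    · rw [hx0 a h, hx0 _ ((hP γ a).2 h), mul_zero]
    · rw [hx1 a h, hx1 _ (mt (hP γ a).1 h), hcls, ← mul_assoc, ← map_mul]
      congr 2
      by_contra hc
      refine h ⟨(γ * g a)⁻¹ * g (γ • a), fun h1 => hc ?_, ?_⟩
      · rw [inv_mul_eq_one] at h1
        exact h1.symm
      · have h1 := hg (γ • a)
        rw [hcls] at h1
        have h2 : (cls a).out = (g a)⁻¹ • a := by rw [eq_inv_smul_iff, hg]
        rw [h2, smul_smul] at h1
        have h3 : (γ * g a)⁻¹ * g (γ • a) = γ⁻¹ * (g (γ • a) * (g a)⁻¹) := by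
          rw [mul_inv]; ac_rfl
        rw [h3, ← smul_smul, h1, inv_smul_smul]
  · by_cases ha : P a
    · by_cases hb : P b
      · exact Or.inr ⟨ha, hb⟩
      · exact absurd (hab.symm.trans (hx0 a ha)) (hne b hb)
    · by_cases hb : P b
      · exact absurd (hab.trans (hx0 b hb)) (hne a ha)
      · left
        rw [hx1 a ha, hx1 b hb] at hab
        have h1 := congrArg norm hab
        rw [norm_mul, norm_mul, norm_rotChar, norm_rotChar, one_mul, one_mul,
          Complex.norm_natCast, Complex.norm_natCast, Nat.cast_inj, Nat.add_right_cancel_iff] at h1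
        have h2 := he h1
        rw [h2] at hab
        have h3 := rotChar_injective
          (mul_right_cancel₀ (Nat.cast_ne_zero.2 (Nat.succ_ne_zero _)) hab)
        rw [← hg a, ← hg b, h2, h3]

end Char

end CnFlex

namespace CnFlex

universe u

/-! ### Places of coordinate rings -/

/-- Infinitely many values of a function on a set of points are taken on one irreducible component
of its closure. -/
theorem exists_isPrime_forall_sub_notMem {k R T : Type*} [Field k] [CommRing R] [Algebra k R]
    [IsNoetherianRing R] (φ : T → R →ₐ[k] k) (r : R) (hr : (Set.range fun t => φ t r).Infinite) :
    ∃ P : Ideal R, P.IsPrime ∧ (∀ f, (∀ t, φ t f = 0) → f ∈ P) ∧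
      ∀ c : k, r - algebraMap k R c ∉ P := by
  let I : Ideal R := ⨅ t, RingHom.ker (φ t)
  have hI : ∀ f, f ∈ I ↔ ∀ t, φ t f = 0 := fun f => by simp [I, RingHom.mem_ker]
  by_contra! hcon
  have h : ∀ P ∈ I.minimalPrimes, ∃ c : k, r - algebraMap k R c ∈ P := fun P hP =>
    hcon P hP.1.1 fun f hf => hP.1.2 ((hI f).2 hf)
  choose! c hc using h
  have hfin := I.finite_minimalPrimes_of_isNoetherianRing R
  refine hr ((hfin.image c).subset ?_)
  rintro _ ⟨t, rfl⟩
  have hmem : ∏ P ∈ hfin.toFinset, (r - algebraMap k R (c P)) ∈ I.radical := by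
    rw [← Ideal.sInf_minimalPrimes, Ideal.mem_sInf]
    intro P hP
    exact Ideal.mem_of_dvd P (Finset.dvd_prod_of_mem _ (hfin.mem_toFinset.2 hP)) (hc P hP)
  obtain ⟨m, hm⟩ := hmem
  have h0 := (hI _).1 hm t
  rw [map_pow] at h0
  have h1 := eq_zero_of_pow_eq_zero h0
  rw [map_prod, Finset.prod_eq_zero_iff] at h1
  obtain ⟨P, hP, h2⟩ := h1
  refine ⟨P, hfin.mem_toFinset.1 hP, ?_⟩
  rw [map_sub, AlgHom.commutes, sub_eq_zero] at h2
  exact h2.symm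

/-- Every non-constant element of an extension of an algebraically closed field has a pole. -/
theorem exists_valuationSubring_notMem {k K : Type*} [Field k] [IsAlgClosed k] [Field K]
    [Algebra k K] {x : K} (hx : ∀ c : k, x ≠ algebraMap k K c) :
    ∃ O : ValuationSubring K, (∀ c : k, algebraMap k K c ∈ O) ∧ x ∉ O := by
  by_contra! hcon
  have h1 : x ∈ (⨅ O : {O : ValuationSubring K // Set.range (algebraMap k K) ⊆ O.toSubring},
      O.1.toSubring) := by
    rw [Subring.mem_iInf]
    exact fun O => hcon O.1 fun c => O.2 ⟨c, rfl⟩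
  rw [iInf_valuationSubring_superset] at h1
  have h2 : IsIntegral (Subring.closure (Set.range (algebraMap k K))) x := h1
  have h3 : IsIntegral k x := by
    obtain ⟨p, hp, hpx⟩ := h2
    have hcl : Subring.closure (Set.range (algebraMap k K)) = (algebraMap k K).range := by
      rw [← RingHom.coe_range, Subring.closure_eq]
    have hlift : p.map (algebraMap _ K) ∈ Polynomial.lifts (algebraMap k K) := by
      rw [Polynomial.lifts_iff_coeff_lifts]
      intro i
      rw [Polynomial.coeff_map]
      refine (RingHom.mem_range).1 ?_
      exact hcl.le (p.coeff i).2
    obtain ⟨q, hq, -, hqm⟩ := Polynomial.lifts_and_natDegree_eq_and_monic hlift (hp.map _)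
    refine ⟨q, hqm, ?_⟩
    rw [← Polynomial.eval_map, hq, Polynomial.eval_map]
    exact hpx
  have h4 : (minpoly k x).degree = 1 :=
    IsAlgClosed.degree_eq_one_of_irreducible k (minpoly.irreducible h3)
  obtain ⟨c, hc⟩ := (minpoly.mem_range_of_degree_eq_one k x h4)
  exact hx c hc.symm

/-- A function with infinitely many values on a set of points has a pole on the closure of the set:
there is a valuation, trivial on constants and defined on the functions on the set, that exceeds
one at the function. -/
theorem exists_valuation_one_lt {k : Type*} {R : Type u} {T : Type*} [Field k] [IsAlgClosed k]
    [CommRing R] [Algebra k R] [IsNoetherianRing R] (φ : T → R →ₐ[k] k) (r : R)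
    (hr : (Set.range fun t => φ t r).Infinite) :
    ∃ (Γ : Type u) (_ : LinearOrderedCommGroupWithZero Γ) (ν : Valuation R Γ),
      (∀ c : k, c ≠ 0 → ν (algebraMap k R c) = 1) ∧
      (∀ f g, (∀ t, φ t f = φ t g) → ν f = ν g) ∧ 1 < ν r := by
  obtain ⟨P, hP, hvan, hr⟩ := exists_isPrime_forall_sub_notMem φ r hr
  let K := FractionRing (R ⧸ P)
  let ψ : R →+* K := (algebraMap (R ⧸ P) K).comp (Ideal.Quotient.mk P)
  have hψ : ∀ f g, ψ f = ψ g ↔ f - g ∈ P := fun f g => by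
    rw [← Ideal.Quotient.eq]
    exact (IsFractionRing.injective (R ⧸ P) K).eq_iff
  let : Algebra k K := (ψ.comp (algebraMap k R)).toAlgebra
  obtain ⟨O, hO, hrO⟩ := exists_valuationSubring_notMem (k := k) (x := ψ r)
    fun c hc => hr c ((hψ _ _).1 hc)
  refine ⟨O.ValueGroup, inferInstance, O.valuation.comap ψ, fun c hc => ?_, fun f g hfg => ?_, ?_⟩
  · have h1 : O.valuation (algebraMap k K c) ≤ 1 := (O.valuation_le_one_iff _).2 (hO c)
    have h2 : O.valuation (algebraMap k K c⁻¹) ≤ 1 := (O.valuation_le_one_iff _).2 (hO _)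
    have h3 : O.valuation (algebraMap k K c) * O.valuation (algebraMap k K c⁻¹) = 1 := by
      rw [← map_mul, ← map_mul, mul_inv_cancel₀ hc, map_one, map_one]
    refine le_antisymm h1 ?_
    calc (1 : O.ValueGroup) = _ := h3.symm
      _ ≤ O.valuation (algebraMap k K c) * 1 := by gcongr
      _ = _ := mul_one _
  · rw [Valuation.comap_apply, Valuation.comap_apply,
      (hψ f g).2 (hvan _ fun t => by rw [map_sub, hfg, sub_self])]
  · rw [Valuation.comap_apply, ← not_le, O.valuation_le_one_iff]
    exact hrO

end CnFlex

namespace CnFlex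

open SimpleGraph

/-! ### Colourings from equivalence relations, and equivariant maps from colourings -/

section Graph

variable {V : Type*} {G : SimpleGraph V} {n : ℕ}

theorem Colour.eq_or_eq {k l : Colour} (h : k ≠ l) (m : Colour) : m = k ∨ m = l := by
  cases k <;> cases l <;> cases m <;> simp_all

theorem Colour.exists_ne (k : Colour) : ∃ l, k ≠ l := by
  cases k
  · exact ⟨.blue, nofun⟩
  · exact ⟨.red, nofun⟩

/-- If a cycle has exactly one edge outside the subgraph `H`, the ends of this edge are connected
in `H`. -/
theorem reachable_of_isCycle {H : SimpleGraph V} {w : V} {c : G.Walk w w} (hc : c.IsCycle)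
    {u v : V} (he : s(u, v) ∈ c.edges) (h : ∀ e ∈ c.edges, e ≠ s(u, v) → e ∈ H.edgeSet) :
    H.Reachable u v := by
  let F := SimpleGraph.fromEdgeSet {e | e ∈ c.edges}
  have hF : ∀ e ∈ c.edges, e ∈ F.edgeSet := fun e hm => by
    rw [edgeSet_fromEdgeSet]
    exact ⟨hm, G.not_isDiag_of_mem_edgeSet (c.edges_subset_edgeSet hm)⟩
  have hr := (adj_and_reachable_delete_edges_iff_exists_cycle (G := F)).2
    ⟨w, c.transfer F hF, hc.transfer hF, by rwa [Walk.edges_transfer]⟩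
  refine hr.2.mono fun x y hxy => ?_
  rw [deleteEdges_adj, fromEdgeSet_adj] at hxy
  exact h _ hxy.1.1 hxy.2

/-- Two equivalence relations, exactly one of which holds across each edge, define a
NAC-colouring. -/
theorem exists_isCnSymmetricNAC (θ : Cyc n →* (G ≃g G)) (S : Colour → Setoid V)
    (hS : ∀ u v, G.Adj u v → (S .red u v ↔ ¬ S .blue u v))
    (hex : ∀ k, ∃ u v, G.Adj u v ∧ S k u v)
    (hinv : ∀ k γ u v, S k (θ γ u) (θ γ v) ↔ S k u v)
    (hpart : ∀ k γ γ' u v, γ ≠ 1 → γ' ≠ 1 → S k u (θ γ u) → S k v (θ γ' v) → S k u v) :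
    ∃ δ : G.EdgeLabeling Colour, IsCnSymmetricNAC θ δ := by
  classical
  let δ : G.EdgeLabeling Colour := EdgeLabeling.mk
    (fun u v _ => if S .red u v then .red else .blue)
    (fun u v _ => by simp only [(S .red).comm' (x := u) (y := v)])
  have hδ : ∀ k u v (h : G.Adj u v), δ ⟨s(u, v), h⟩ = k ↔ S k u v := by
    intro k u v h
    change (if S .red u v then Colour.red else .blue) = k ↔ _
    have := hS u v h
    cases k <;> split_ifs <;> simp_all
  have hreach : ∀ k u v, (δ.labelGraph k).Reachable u v → S k u v := by
    rintro k u v ⟨p⟩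
    induction p with
    | nil => exact (S k).refl' _
    | cons h p ih =>
      obtain ⟨ha, hk⟩ := (EdgeLabeling.labelGraph_adj _ _).1 h
      exact (S k).trans' ((hδ _ _ _ ha).1 hk) ih
  refine ⟨δ, ⟨⟨fun k => ?_, fun w c hc => ?_⟩, ?_, ?_⟩⟩
  · obtain ⟨u, v, h, hs⟩ := hex k
    exact ⟨⟨s(u, v), h⟩, (hδ k u v h).2 hs⟩
  · by_contra! hcon
    obtain ⟨hmono, k, hk⟩ := hcon
    obtain ⟨l, hkl⟩ := k.exists_ne
    obtain ⟨⟨e, he⟩, hec, hel⟩ := hmono l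
    have hek : δ ⟨e, he⟩ = k := (Colour.eq_or_eq hkl _).resolve_right hel
    have hoth : ∀ f : G.edgeSet, (f : Sym2 V) ∈ c.edges → (f : Sym2 V) ≠ e → δ f = l :=
      fun f hf hne => (Colour.eq_or_eq hkl _).resolve_left
        (hk ⟨e, he⟩ f (fun h => hne (congrArg Subtype.val h).symm) hec hf hek)
    induction e using Sym2.ind with
    | _ u v =>
      have hr : (δ.labelGraph l).Reachable u v := by
        refine reachable_of_isCycle hc hec fun f hf hne => ?_
        have hfG := c.edges_subset_edgeSet hf
        have hfl := hoth ⟨f, hfG⟩ hf hne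
        rw [EdgeLabeling.labelGraph, edgeSet_fromEdgeSet]
        exact ⟨⟨hfG, hfl⟩, G.not_isDiag_of_mem_edgeSet hfG⟩
      exact hel ((hδ l u v he).2 (hreach _ _ _ hr))
  · rintro γ ⟨e, he⟩
    induction e using Sym2.ind with
    | _ u v =>
      exact (hδ _ (θ γ u) (θ γ v) ((θ γ).map_adj_iff.2 he)).2
        ((hinv _ γ u v).2 ((hδ _ u v he).1 rfl))
  · rintro k H₁ H₂ hne ⟨γ₁, h₁, hH₁⟩ ⟨γ₂, h₂, hH₂⟩ u hu v hv huv
    have key : ∀ (H : (δ.labelGraph k).ConnectedComponent) (γ : Cyc n),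
        translate θ γ (componentSubgraph δ k H) = componentSubgraph δ k H →
        ∀ x ∈ H.supp, S k x (θ γ x) := by
      intro H γ hH x hx
      refine hreach _ _ _ (H.reachable_of_mem_supp hx ?_)
      have : θ γ x ∈ (translate θ γ (componentSubgraph δ k H)).verts := ⟨x, hx, rfl⟩
      rwa [hH] at this
    have hs := hpart k γ₁ γ₂ u v h₁ h₂ (key _ _ hH₁ u hu) (key _ _ hH₂ v hv)
    have hadj : (δ.labelGraph k).Adj u v :=
      (EdgeLabeling.labelGraph_adj _ _).2 ⟨huv, (hδ k u v huv).2 hs⟩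
    exact hne (ConnectedComponent.eq_of_common_vertex hu
      ((H₂.mem_supp_congr_adj hadj).2 hv))

/-- In a NAC-colouring the ends of an edge are not connected by edges of the other colour. -/
theorem IsNAC.connectedComponentMk_ne {δ : G.EdgeLabeling Colour} (hδ : IsNAC δ) {k : Colour}
    {u v : V} (h : G.Adj u v) (hk : δ ⟨s(u, v), h⟩ ≠ k) :
    (δ.labelGraph k).connectedComponentMk u ≠ (δ.labelGraph k).connectedComponentMk v := by
  intro heq
  obtain ⟨p, hp⟩ := (ConnectedComponent.exact heq).symm.exists_isPath
  have hpk : ∀ e : G.edgeSet, (e : Sym2 V) ∈ p.edges → δ e = k := fun e he => by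
    have := p.edges_subset_edgeSet he
    rw [EdgeLabeling.labelGraph, edgeSet_fromEdgeSet] at this
    exact this.1.2
  let q := p.mapLe (δ.labelGraph_le (k := k))
  have hqe : q.edges = p.edges := Walk.edges_mapLe_eq_edges _ _
  have hq : q.IsPath := (Walk.isPath_mapLe _).2 hp
  have hcyc : (Walk.cons h q).IsCycle := by
    refine (Walk.cons_isCycle_iff q h).2 ⟨hq, fun hm => hk (hpk ⟨_, h⟩ ?_)⟩
    rwa [hqe] at hm
  have hedge : ∀ e : G.edgeSet, (e : Sym2 V) ∈ (Walk.cons h q).edges → δ e ≠ k →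
      e = ⟨s(u, v), h⟩ := fun e he hek => by
    rw [Walk.edges_cons, List.mem_cons, hqe] at he
    exact Subtype.ext (he.resolve_right fun hm => hek (hpk e hm))
  rcases hδ.cycle u _ hcyc with ⟨l, hl⟩ | h2
  · have hlk : l ≠ k := fun e => hk ((hl ⟨_, h⟩ (by simp)).trans e)
    cases hpc : p with
    | nil => exact G.irrefl h
    | cons h' p' =>
      obtain ⟨ha, hc⟩ := (EdgeLabeling.labelGraph_adj _ _).1 h'
      refine hlk ((hl ⟨_, ha⟩ ?_).symm.trans hc)
      rw [Walk.edges_cons, hqe, hpc]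
      simp
  · obtain ⟨e, f, hne, he, hf, hek, hfk⟩ := h2 (δ ⟨s(u, v), h⟩)
    exact hne ((hedge e he (hek ▸ hk)).trans (hedge f hf (hfk ▸ hk)).symm)

/-- A graph automorphism that preserves the colouring acts on the graph of each colour. -/
def labelGraphHom {θ : Cyc n →* (G ≃g G)} {δ : G.EdgeLabeling Colour}
    (h : ∀ (γ : Cyc n) (e : G.edgeSet), δ ((θ γ).mapEdgeSet e) = δ e) (k : Colour) (γ : Cyc n) :
    δ.labelGraph k →g δ.labelGraph k where
  toFun := θ γ
  map_rel' {u v} huv := by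
    obtain ⟨ha, hc⟩ := (EdgeLabeling.labelGraph_adj _ _).1 huv
    exact (EdgeLabeling.labelGraph_adj _ _).2
      ⟨(θ γ).map_adj_iff.2 ha, (h γ ⟨s(u, v), ha⟩).trans hc⟩

/-- The action of the cyclic group on the components of one colour. -/
abbrev componentAction {θ : Cyc n →* (G ≃g G)} {δ : G.EdgeLabeling Colour}
    (h : ∀ (γ : Cyc n) (e : G.edgeSet), δ ((θ γ).mapEdgeSet e) = δ e) (k : Colour) :
    MulAction (Cyc n) (δ.labelGraph k).ConnectedComponent where
  smul γ H := H.map (labelGraphHom h k γ)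
  one_smul H := by
    induction H using ConnectedComponent.ind with
    | _ v =>
      change (δ.labelGraph k).connectedComponentMk (θ 1 v) = _
      rw [map_one]; rfl
  mul_smul γ γ' H := by
    induction H using ConnectedComponent.ind with
    | _ v =>
      change (δ.labelGraph k).connectedComponentMk (θ (γ * γ') v) = _
      rw [map_mul]; rfl

theorem translate_componentSubgraph {θ : Cyc n →* (G ≃g G)} {δ : G.EdgeLabeling Colour}
    (h : ∀ (γ : Cyc n) (e : G.edgeSet), δ ((θ γ).mapEdgeSet e) = δ e) (k : Colour) (γ : Cyc n)
    (H : (δ.labelGraph k).ConnectedComponent) (hH : H.map (labelGraphHom h k γ) = H) :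
    translate θ γ (componentSubgraph δ k H) = componentSubgraph δ k H := by
  have hright : ∀ v, θ γ (θ γ⁻¹ v) = v := fun v => by
    rw [← RelIso.mul_apply, ← map_mul, mul_inv_cancel, map_one]; rfl
  have hleft : ∀ v, θ γ⁻¹ (θ γ v) = v := fun v => by
    rw [← RelIso.mul_apply, ← map_mul, inv_mul_cancel, map_one]; rfl
  have hmem : ∀ v, θ γ v ∈ H.supp ↔ v ∈ H.supp := fun v => by
    rw [ConnectedComponent.mem_supp_iff, ConnectedComponent.mem_supp_iff]
    constructor
    · intro hv
      rw [← hH] at hv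
      have := congrArg (ConnectedComponent.map (labelGraphHom h k γ⁻¹)) hv
      induction H using ConnectedComponent.ind with
      | _ w =>
        change (δ.labelGraph k).connectedComponentMk (θ γ⁻¹ (θ γ v)) =
          (δ.labelGraph k).connectedComponentMk (θ γ⁻¹ (θ γ w)) at this
        rwa [hleft, hleft] at this
    · intro hv
      rw [← hH, ← hv]; rfl
  ext u v
  · constructor
    · rintro ⟨w, hw, rfl⟩
      exact (hmem w).2 hw
    · intro hu
      exact ⟨θ γ⁻¹ u, (hmem _).1 (by rwa [hright]), hright u⟩
  · constructor
    · rintro ⟨x, y, ⟨hxy, hx⟩, rfl, rfl⟩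
      exact ⟨(labelGraphHom h k γ).map_adj hxy, (hmem x).2 hx⟩
    · rintro ⟨huv, hu⟩
      refine ⟨θ γ⁻¹ u, θ γ⁻¹ v, ⟨(labelGraphHom h k γ⁻¹).map_adj huv, ?_⟩, hright u, hright v⟩
      exact (hmem _).1 (by rwa [hright])

/-- The components of one colour of a symmetric NAC-colouring can be placed equivariantly in the
plane such that the ends of each edge of the other colour are separated. -/
theorem IsCnSymmetricNAC.exists_equivariant [Finite V] [NeZero n] {θ : Cyc n →* (G ≃g G)}
    {δ : G.EdgeLabeling Colour} (hδ : IsCnSymmetricNAC θ δ) (k : Colour) :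
    ∃ x : V → ℂ, (∀ γ v, x (θ γ v) = rotChar n γ * x v) ∧
      ∀ u v (h : G.Adj u v), (x u = x v ↔ δ ⟨s(u, v), h⟩ = k) := by
  let := componentAction hδ.invariant k
  obtain ⟨x, hx, hinj⟩ := CnFlex.exists_equivariant (n := n) (δ.labelGraph k).ConnectedComponent
  refine ⟨fun v => x ((δ.labelGraph k).connectedComponentMk v), fun γ v => hx γ ((δ.labelGraph k).connectedComponentMk v),
    fun u v h => ⟨fun he => ?_, fun hk => ?_⟩⟩
  · by_contra hk
    have hne := hδ.nac.connectedComponentMk_ne h hk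
    obtain ⟨⟨γ₁, h₁, hH₁⟩, γ₂, h₂, hH₂⟩ := (hinj _ _ he).resolve_left hne
    exact hδ.not_joined k _ _ hne
      ⟨γ₁, h₁, translate_componentSubgraph hδ.invariant k γ₁ _ hH₁⟩
      ⟨γ₂, h₂, translate_componentSubgraph hδ.invariant k γ₂ _ hH₂⟩ u rfl v rfl h
  · exact congrArg x (ConnectedComponent.connectedComponentMk_eq_of_adj
      ((EdgeLabeling.labelGraph_adj _ _).2 ⟨h, hk⟩))

/-- In a connected graph with edges of both colours, there are adjacent edges of different
colours. -/
theorem exists_adj_adj_ne (hG : G.Connected) {δ : G.EdgeLabeling Colour}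
    (hδ : Function.Surjective δ) :
    ∃ u v w, ∃ (h : G.Adj u v) (h' : G.Adj v w), δ ⟨s(u, v), h⟩ = .red ∧
      δ ⟨s(v, w), h'⟩ = .blue := by
  by_contra! hcon
  obtain ⟨⟨e, he⟩, hr⟩ := hδ .red
  obtain ⟨⟨f, hf⟩, hb⟩ := hδ .blue
  induction e using Sym2.ind with
  | _ a b =>
  induction f using Sym2.ind with
  | _ c d =>
  have key : ∀ x, G.Reachable a x → ∃ y, ∃ h : G.Adj y x, δ ⟨s(y, x), h⟩ = .red := by
    intro x hx
    rw [reachable_iff_reflTransGen] at hx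
    induction hx with
    | refl =>
      refine ⟨b, Adj.symm he, ?_⟩
      rw [← hr]; congr 2; exact Sym2.eq_swap
    | tail _ h ih =>
      obtain ⟨y, hy, hyr⟩ := ih
      exact ⟨_, h, (Colour.eq_or_eq (k := .red) (l := .blue) nofun _).resolve_right
        (hcon _ _ _ hy h hyr)⟩
  obtain ⟨y, hy, hyr⟩ := key c (hG.preconnected a c)
  exact hcon _ _ _ hy hf hyr hb

end Graph

end CnFlex

namespace CnFlex

open SimpleGraph

section Main

variable {V : Type*} {G : SimpleGraph V} {n : ℕ}

theorem norm_toComplex_sub (x y : Plane) : ‖toComplex x - toComplex y‖ = ‖x - y‖ := by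
  rw [← map_sub, LinearIsometryEquiv.norm_map]

theorem eq_zero_or_eq_zero_of_norm_add_eq {a b : ℂ} (h : ‖a + -b‖ = ‖a + b‖)
    (h' : ‖a + Complex.I * b‖ = ‖a + b‖) : a = 0 ∨ b = 0 := by
  have h1 := congrArg (· ^ 2) h
  have h2 := congrArg (· ^ 2) h'
  simp only [Complex.sq_norm, Complex.normSq_apply, Complex.add_re, Complex.add_im,
    Complex.neg_re, Complex.neg_im, Complex.mul_re, Complex.mul_im, Complex.I_re,
    Complex.I_im] at h1 h2
  have h3 : a.re * b.re + a.im * b.im = 0 := by linarith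
  have h4 : a.im * b.re - a.re * b.im = 0 := by linarith
  rw [← Complex.normSq_eq_zero, ← Complex.normSq_eq_zero (z := b), ← mul_eq_zero,
    Complex.normSq_apply, Complex.normSq_apply]
  linear_combination (a.re * b.re + a.im * b.im) * h3 + (a.im * b.re - a.re * b.im) * h4

/-- A symmetric NAC-colouring yields a flexible symmetric placement: the positions are the sums of
an equivariant placement of the red components and a rotating one of the blue components. -/
theorem exists_isCnSymmetricFlexiblePlacement [Finite V] (hG : G.Connected) [NeZero n]
    {θ : Cyc n →* (G ≃g G)} {δ : G.EdgeLabeling Colour} (hδ : IsCnSymmetricNAC θ δ) :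
    ∃ p : V → Plane, IsCnSymmetricFlexiblePlacement θ p := by
  obtain ⟨x, hx, hxe⟩ := hδ.exists_equivariant .red
  obtain ⟨y, hy, hye⟩ := hδ.exists_equivariant .blue
  let c : unitInterval → ℂ := fun t => Complex.exp ((Real.pi * t : ℝ) * Complex.I)
  have hc : ∀ t, ‖c t‖ = 1 := fun t => Complex.norm_exp_ofReal_mul_I _
  have hcc : Continuous c := by fun_prop
  have hc0 : c 0 = 1 := by simp [c]
  have hc1 : c 1 = -1 := by simp [c]
  have hc2 : c ⟨1 / 2, by norm_num, by norm_num⟩ = Complex.I := by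
    have h : Real.pi * (1 / 2) = Real.pi / 2 := by ring
    simp only [c, h]
    push_cast
    exact Complex.exp_pi_div_two_mul_I
  let f : unitInterval → V → Plane := fun t v => toComplex.symm (x v + c t * y v)
  have hf : ∀ t v, toComplex (f t v) = x v + c t * y v := fun t v =>
    toComplex.apply_symm_apply _
  have hnorm : ∀ t u v, ‖f t u - f t v‖ = ‖(x u - x v) + c t * (y u - y v)‖ := fun t u v => by
    rw [← norm_toComplex_sub, hf, hf]
    congr 1
    ring
  have hred : ∀ u v (h : G.Adj u v), δ ⟨s(u, v), h⟩ = .red → x u = x v ∧ y u ≠ y v :=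
    fun u v h hr => ⟨(hxe u v h).2 hr, fun he => by
      have := (hye u v h).1 he
      rw [hr] at this
      cases this⟩
  have hblue : ∀ u v (h : G.Adj u v), δ ⟨s(u, v), h⟩ = .blue → y u = y v ∧ x u ≠ x v :=
    fun u v h hr => ⟨(hye u v h).2 hr, fun he => by
      have := (hxe u v h).1 he
      rw [hr] at this
      cases this⟩
  have hedge : ∀ t u v, G.Adj u v → ‖f t u - f t v‖ = ‖x u - x v‖ + ‖y u - y v‖ ∧
      ‖f t u - f t v‖ ≠ 0 := by
    intro t u v h
    rw [hnorm]
    rcases Colour.eq_or_eq (k := .red) (l := .blue) nofun (δ ⟨s(u, v), h⟩) with hk | hk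
    · obtain ⟨h1, h2⟩ := hred u v h hk
      simp [h1, hc, sub_ne_zero.2 h2]
    · obtain ⟨h1, h2⟩ := hblue u v h hk
      simp [h1, sub_ne_zero.2 h2]
  have hplace : ∀ t, IsPlacement G (f t) := fun t u v h he =>
    (hedge t u v h).2 (by rw [he, sub_self, norm_zero])
  have hsym : ∀ t, IsCnSymmetricMap θ (f t) := fun t => isCnSymmetricMap_iff.2 fun γ v => by
    rw [hf, hf, hx, hy]
    ring
  refine ⟨f 0, hplace 0, hsym 0, f, ⟨?_, rfl, hplace, fun t u v h => ?_⟩, hsym, fun htriv => ?_⟩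
  · refine continuous_pi fun v => toComplex.symm.continuous.comp ?_
    fun_prop
  · rw [(hedge t u v h).1, (hedge 0 u v h).1]
  · obtain ⟨u, v, w, h, h', hr, hb⟩ := exists_adj_adj_ne hG hδ.nac.surjective
    obtain ⟨h1, h2⟩ := hred u v h hr
    obtain ⟨h3, h4⟩ := hblue v w h' hb
    have key : ∀ t, ‖(x u - x w) + c t * (y u - y w)‖ = ‖(x u - x w) + (y u - y w)‖ := fun t => by
      rw [← hnorm, htriv t u w, hnorm, hc0, one_mul]
    refine (eq_zero_or_eq_zero_of_norm_add_eq (neg_one_mul (y u - y w) ▸ hc1 ▸ key 1)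
      (hc2 ▸ key ⟨1 / 2, by norm_num, by norm_num⟩)).elim (fun h0 => h4 ?_) fun h0 => h2 ?_
    · rw [← h1, sub_eq_zero.1 h0]
    · rw [sub_eq_zero.1 h0, h3]

/-- If the edge vectors of two placements have the same mutual positions, all distances agree. -/
theorem norm_sub_eq_of_edges (hG : G.Connected) {p q : V → ℂ}
    (hpq : ∀ u v, G.Adj u v → ‖p u - p v‖ = ‖q u - q v‖)
    (hp : ∀ u v, G.Adj u v → p u ≠ p v)
    (h : ∀ a b c d, G.Adj a b → G.Adj c d → (p a - p b) * star (p c - p d) =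
      (q a - q b) * star (q c - q d)) (u v : V) : ‖p u - p v‖ = ‖q u - q v‖ := by
  by_cases huv : u = v
  · simp [huv]
  obtain ⟨c, hc⟩ := (hG.preconnected u v).nonempty_neighborSet_left huv
  have hc : G.Adj u c := hc
  have key : ∀ x, G.Reachable u x → (p u - p x) * star (p u - p c) =
      (q u - q x) * star (q u - q c) := by
    intro x hx
    rw [reachable_iff_reflTransGen] at hx
    induction hx with
    | refl => simp
    | tail _ hyz ih =>
      have := h _ _ _ _ hyz hc
      linear_combination ih + this
  have h1 := congrArg norm (key v (hG.preconnected u v))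
  rw [norm_mul, norm_mul, norm_star, norm_star, hpq u c hc] at h1
  refine mul_right_cancel₀ ?_ h1
  rw [← hpq u c hc]
  exact norm_ne_zero_iff.2 (sub_ne_zero.2 (hp u c hc))

/-- A valuation exceeds a bound on the differences in an equivalence relation. -/
def valuationSetoid {R Γ : Type*} [CommRing R] [LinearOrderedCommGroupWithZero Γ]
    (ν : Valuation R Γ) (y : V → R) (B : Set Γ) (hB : IsLowerSet B) (h0 : 0 ∈ B) : Setoid V where
  r u v := ν (y u - y v) ∈ B
  iseqv :=
    { refl := fun u => by rwa [sub_self, map_zero]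
      symm := fun {u v} h => by rwa [Valuation.map_sub_swap]
      trans := fun {u v w} h h' => by
        have h1 := ν.map_add (y u - y v) (y v - y w)
        rw [sub_add_sub_cancel] at h1
        rcases le_max_iff.1 h1 with h2 | h2
        · exact hB h2 h
        · exact hB h2 h' }

/-- A family of equivariant placements with constant edge lengths in which the mutual position of
two edges changes yields a symmetric NAC-colouring. -/
theorem exists_isCnSymmetricNAC_of_infinite [Finite V] [NeZero n] (θ : Cyc n →* (G ≃g G))
    {T : Type*} (q : T → V → ℂ) (ℓ : V → V → ℂ)
    (hℓ : ∀ t u v, G.Adj u v → (q t u - q t v) * star (q t u - q t v) = ℓ u v)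
    (hℓ0 : ∀ u v, G.Adj u v → ℓ u v ≠ 0)
    (hsym : ∀ t γ v, q t (θ γ v) = rotChar n γ * q t v)
    {a b c d : V} (hab : G.Adj a b) (hcd : G.Adj c d)
    (hinf : (Set.range fun t => (q t a - q t b) * star (q t c - q t d)).Infinite) :
    ∃ δ : G.EdgeLabeling Colour, IsCnSymmetricNAC θ δ := by
  let R := MvPolynomial (V ⊕ V) ℂ
  let w : V → R := fun v => MvPolynomial.X (Sum.inl v)
  let z : V → R := fun v => MvPolynomial.X (Sum.inr v)
  let φ : T → R →ₐ[ℂ] ℂ := fun t =>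
    MvPolynomial.aeval (Sum.elim (q t) fun v => star (q t v))
  have hφw : ∀ t v, φ t (w v) = q t v := fun t v => MvPolynomial.aeval_X _ _
  have hφz : ∀ t v, φ t (z v) = star (q t v) := fun t v => MvPolynomial.aeval_X _ _
  obtain ⟨Γ, _, ν, hconst, hcongr, hr⟩ :=
    exists_valuation_one_lt φ ((w a - w b) * (z c - z d)) (by
      simpa only [map_mul, map_sub, hφw, hφz, star_sub] using hinf)
  have hmul : ∀ u v, G.Adj u v → ν (w u - w v) * ν (z u - z v) = 1 := fun u v h => by
    rw [← map_mul, ← hconst _ (hℓ0 u v h)]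
    refine hcongr _ _ fun t => ?_
    rw [map_mul, map_sub, map_sub, hφw, hφw, hφz, hφz, AlgHom.commutes, ← star_sub, hℓ t u v h]
    rfl
  have hequiv : ∀ (y : V → R) (χ : Cyc n → ℂ), (∀ γ, χ γ ≠ 0) →
      (∀ t γ v, φ t (y (θ γ v)) = χ γ * φ t (y v)) →
      (∀ γ u v, ν (y (θ γ u) - y (θ γ v)) = ν (y u - y v)) ∧
      ∀ γ v, χ γ ≠ 1 → ν (y v - y (θ γ v)) = ν (y v) := by
    intro y χ h0 hy
    constructor
    · intro γ u v
      rw [← one_mul (ν (y u - y v)), ← hconst _ (h0 γ), ← map_mul]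
      refine hcongr _ _ fun t => ?_
      rw [map_sub, hy, hy, map_mul, AlgHom.commutes, map_sub, mul_sub]
      rfl
    · intro γ v h1
      rw [← one_mul (ν (y v)), ← hconst (1 - χ γ) (sub_ne_zero.2 h1.symm), ← map_mul]
      refine hcongr _ _ fun t => ?_
      rw [map_sub, hy, map_mul, AlgHom.commutes, Algebra.algebraMap_self_apply,
        sub_mul, one_mul]
  have hW := hequiv w (fun γ => rotChar n γ) rotChar_ne_zero
    fun t γ v => by rw [hφw, hφw, hsym]
  have hZ := hequiv z (fun γ => star (rotChar n γ)) (fun γ => star_ne_zero.2 (rotChar_ne_zero γ))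
    fun t γ v => by rw [hφz, hφz, hsym, star_mul']
  have hZ1 : ∀ γ : Cyc n, γ ≠ 1 → star (rotChar n γ) ≠ 1 := fun γ hγ h =>
    rotChar_ne_one hγ (by rw [← star_star (rotChar n γ), h, star_one])
  set α := ν (w c - w d) with hα
  have hα0 : α ≠ 0 := left_ne_zero_of_mul_eq_one (hmul c d hcd)
  have hpart : ∀ (y : V → R) (B : Set Γ), IsLowerSet B → ∀ u v,
      ν (y u) ∈ B → ν (y v) ∈ B → ν (y u - y v) ∈ B := fun y B hB u v hu hv => by
    rcases le_max_iff.1 (ν.map_sub (y u) (y v)) with h | h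
    · exact hB h hu
    · exact hB h hv
  let Sw := valuationSetoid ν w (Set.Iic α) (isLowerSet_Iic α) zero_le
  let Sz := valuationSetoid ν z (Set.Iio α⁻¹) (isLowerSet_Iio _) (by simp [zero_lt_iff, hα0])
  refine exists_isCnSymmetricNAC θ (fun k => Colour.rec Sw Sz k) ?_ ?_ ?_ ?_
  · intro u v h
    change ν (w u - w v) ≤ α ↔ ¬ ν (z u - z v) < α⁻¹
    have h1 := hmul u v h
    rw [eq_inv_of_mul_eq_one_right h1, not_lt, inv_le_inv₀ (zero_lt_iff.2 hα0)
      (zero_lt_iff.2 (left_ne_zero_of_mul_eq_one h1))]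
  · rintro (_ | _)
    · exact ⟨c, d, hcd, le_refl α⟩
    · refine ⟨a, b, hab, ?_⟩
      change ν (z a - z b) < α⁻¹
      have h1 := hmul a b hab
      rw [eq_inv_of_mul_eq_one_right h1, inv_lt_inv₀
        (zero_lt_iff.2 (left_ne_zero_of_mul_eq_one h1)) (zero_lt_iff.2 hα0)]
      rw [map_mul, eq_inv_of_mul_eq_one_right (hmul c d hcd), ← div_eq_mul_inv,
        one_lt_div₀ (zero_lt_iff.2 hα0)] at hr
      exact hr
  · rintro (_ | _) γ u v
    · change ν _ ≤ α ↔ ν _ ≤ α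
      rw [hW.1]
    · change ν _ < α⁻¹ ↔ ν _ < α⁻¹
      rw [hZ.1]
  · rintro (_ | _) γ γ' u v hγ hγ' hu hv
    · change ν _ ≤ α at hu hv
      rw [hW.2 _ _ (rotChar_ne_one hγ)] at hu
      rw [hW.2 _ _ (rotChar_ne_one hγ')] at hv
      exact hpart w _ (isLowerSet_Iic α) u v hu hv
    · change ν _ < α⁻¹ at hu hv
      rw [hZ.2 _ _ (hZ1 _ hγ)] at hu
      rw [hZ.2 _ _ (hZ1 _ hγ')] at hv
      exact hpart z _ (isLowerSet_Iio _) u v hu hv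

theorem IsCnSymmetricFlexiblePlacement.exists_isCnSymmetricNAC [Finite V] (hG : G.Connected)
    [NeZero n] {θ : Cyc n →* (G ≃g G)} {p : V → Plane}
    (hp : IsCnSymmetricFlexiblePlacement θ p) :
    ∃ δ : G.EdgeLabeling Colour, IsCnSymmetricNAC θ δ := by
  obtain ⟨hplace, -, f, hf, hsym, hnt⟩ := hp
  let q : unitInterval → V → ℂ := fun t v => toComplex (f t v)
  have hq : ∀ v, Continuous fun t => q t v := fun v =>
    toComplex.continuous.comp ((continuous_apply v).comp hf.continuous)
  have hnorm : ∀ t u v, G.Adj u v → ‖q t u - q t v‖ = ‖p u - p v‖ := fun t u v h => by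
    rw [norm_toComplex_sub, hf.equivalent t u v h]
  by_cases hcon : ∀ t a b c d, G.Adj a b → G.Adj c d → (q t a - q t b) * star (q t c - q t d) =
      (q 0 a - q 0 b) * star (q 0 c - q 0 d)
  · refine absurd (fun t u v => ?_) hnt
    rw [← norm_toComplex_sub, ← hf.start, ← norm_toComplex_sub]
    exact norm_sub_eq_of_edges hG (fun u v h => by rw [hnorm t u v h, hnorm 0 u v h])
      (fun u v h he => hf.placement t u v h (toComplex.injective he)) (hcon t) u v
  · push Not at hcon
    obtain ⟨t, a, b, c, d, hab, hcd, hne⟩ := hcon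
    refine exists_isCnSymmetricNAC_of_infinite θ q (fun u v => ((‖p u - p v‖ ^ 2 : ℝ) : ℂ))
      (fun t u v h => ?_) (fun u v h => ?_) (fun t => isCnSymmetricMap_iff.1 (hsym t)) hab hcd ?_
    · rw [← hnorm t u v h, Complex.star_def, Complex.mul_conj']
      push_cast
      rfl
    · exact Complex.ofReal_ne_zero.2 (pow_ne_zero 2
        (norm_ne_zero_iff.2 (sub_ne_zero.2 (hplace u v h))))
    · refine (isPreconnected_range ?_).infinite_of_nontrivial ⟨_, ⟨t, rfl⟩, _, ⟨0, rfl⟩, hne⟩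
      exact ((hq a).sub (hq b)).mul ((hq c).sub (hq d)).star

end Main

end CnFlex

theorem theorem1 {V : Type*} [Finite V] (G : SimpleGraph V) (hG : G.Connected)
    (n : ℕ) (hn : 2 ≤ n) (θ : CnFlex.Cyc n →* (G ≃g G)) (hθ : CnFlex.IsCnSymmetricGraph θ) :
    (∃ p : V → CnFlex.Plane, CnFlex.IsCnSymmetricFlexiblePlacement θ p) ↔
      ∃ δ : G.EdgeLabeling CnFlex.Colour, CnFlex.IsCnSymmetricNAC θ δ := by
  have : NeZero n := ⟨by omega⟩
  exact ⟨fun ⟨_, hp⟩ => hp.exists_isCnSymmetricNAC hG,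
    fun ⟨_, hδ⟩ => CnFlex.exists_isCnSymmetricFlexiblePlacement hG hδ⟩
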